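/- Let $E$ be a locally compact separable metric space with its Borel $\sigma$-algebra and let $m$ be a $\sigma$-finite Borel measure on $E$ with full support. Let $(P_t)_{t\ge 0}$ be a normal sub-Markovian transition function on $E$ (for example, that of a Borel right Markov process with values in $E$): kernels $P_t(x,dy)$ with $P_t(x,E)\le 1$, $P_0(x,\cdot)=\delta_x$ and $P_{s+t}=P_sP_t$. Assume that $(P_t)$ is $m$-symmetric in the following sense: it extends (from the bounded Borel functions in $L^2(m)$, on which $P_tf(x)=\int f(y)\,P_t(x,dy)$ for $m$-a.e. $x$) to a strongly continuous sub-Markovian contraction semigroup on the real Hilbert space $L^2(m)=L^2(E,m)$, again denoted by $(P_t)$, with $(P_tf,g)=(f,P_tg)$ for all $f,g\in L^2(m)$. Let $A$ be its generator, $Af=\lim_{t\downarrow 0}\frac{P_tf-f}{t}$ in $L^2(m)$, whose domain $\mathcal D(A)$ is the set of all $f\in L^2(m)$ for which this limit exists in $L^2(m)$. Fix $T>0$. Then $P_T$ is injective on $L^2(m)$. Let $P_T^{-1}$ denote its inverse, with domain $\mathcal D(P_T^{-1})=\{P_Tf: f\in L^2(m)\}$, so that $P_T^{-1}g=f$ if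 $P_Tf=g$. For $g\in L^2(m)$, a *solution in $L^2(m)$* of $$u_t+Au=0,\qquad u(0)=g \qquad\qquad (*)$$ on $[0,T]$ is a norm-continuous map $u:[0,T]\to L^2(m)$ with $u(0)=g$ such that, for every $t\in(0,T)$, $u(t)\in\mathcal D(A)$, the limit $u_t(t)=\lim_{h\to 0}\frac{u(t+h)-u(t)}{h}$ exists in $L^2(m)$, and $u_t(t)+Au(t)=0$. Then, for every $g\in L^2(m)$: 1. If $g\in\mathcal D(P_T^{-1})$, then $(*)$ has a solution in $L^2(m)$ on $[0,T]$. 2. Conversely, if $(*)$ has a solution in $L^2(m)$ on $[0,T]$, then $g\in\mathcal D(P_T^{-1})$. 3. Consequently, $(*)$ has a unique solution in $L^2(m)$ on $[0,T]$ if and only if $g\in\mathcal D(P_T^{-1})$. 4. Every solution $u$ of $(*)$ in $L^2(m)$ on $[0,T]$ satisfies $u(T)=P_T^{-1}g$. -/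

import Mathlib

open Set Filter Topology MeasureTheory ProbabilityTheory
open scoped NNReal ENNReal

namespace BackwardCauchy

/-- A normal sub-Markovian transition function on `E`: a family of Borel kernels of total mass at
most one (the missing mass being the probability that the process has been killed), with `p 0 x` the
Dirac mass at `x`, satisfying the Chapman-Kolmogorov equations. -/
structure IsTransitionFunction {E : Type*} [MeasurableSpace E] (p : ℝ≥0 → Kernel E E) : Prop where
  measure_univ_le_one : ∀ (t : ℝ≥0) (x : E), p t x univ ≤ 1
  zero : p 0 = Kernel.id
  add : ∀ s t : ℝ≥0, p (s + t) = p s ∘ₖ p t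

/-- Strongly continuous semigroups of contractions on a Banach space. -/
structure IsContractionSemigroup {H : Type*} [NormedAddCommGroup H] [NormedSpace ℝ H]
    (P : ℝ≥0 → H →L[ℝ] H) : Prop where
  zero : P 0 = ContinuousLinearMap.id ℝ H
  add : ∀ s t : ℝ≥0, P (s + t) = (P s).comp (P t)
  norm_le_one : ∀ t : ℝ≥0, ‖P t‖ ≤ 1
  strongly_continuous : ∀ f : H, Tendsto (fun t : ℝ≥0 => P t f) (𝓝[>] 0) (𝓝 f)

/-- `P` is the strongly continuous symmetric sub-Markovian semigroup on the real Hilbert space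
`L²(E, m)` that extends the transition function `p`. -/
structure IsSymmetricL2Semigroup {E : Type*} [MeasurableSpace E] (m : Measure E)
    (p : ℝ≥0 → Kernel E E) (P : ℝ≥0 → Lp ℝ 2 m →L[ℝ] Lp ℝ 2 m) : Prop where
  transition : IsTransitionFunction p
  semigroup : IsContractionSemigroup P
  /-- on bounded Borel functions in `L²(m)`, `P t` acts by integration against the kernel `p t` -/
  extends_kernel : ∀ (t : ℝ≥0) (f : E → ℝ) (_ : Measurable f) (_ : ∃ C : ℝ, ∀ x, |f x| ≤ C)
    (hf : MemLp f 2 m), P t (hf.toLp f) =ᵐ[m] fun x => ∫ y, f y ∂(p t x)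
  sub_markovian : ∀ (t : ℝ≥0) (f : Lp ℝ 2 m), (∀ᵐ x ∂m, 0 ≤ f x ∧ f x ≤ 1) →
    ∀ᵐ x ∂m, 0 ≤ P t f x ∧ P t f x ≤ 1
  symmetric : ∀ (t : ℝ≥0) (f g : Lp ℝ 2 m), inner ℝ (P t f) g = inner ℝ f (P t g)

section Operators

variable {H : Type*} [NormedAddCommGroup H] [NormedSpace ℝ H]

/-- `(P t f - f) / t` converges to `a` in norm as `t ↓ 0`. -/
def HasGeneratorValue (P : ℝ≥0 → H →L[ℝ] H) (f a : H) : Prop :=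
  Tendsto (fun t : ℝ≥0 => (t : ℝ)⁻¹ • (P t f - f)) (𝓝[>] 0) (𝓝 a)

theorem HasGeneratorValue.unique {P : ℝ≥0 → H →L[ℝ] H} {f a b : H}
    (ha : HasGeneratorValue P f a) (hb : HasGeneratorValue P f b) : a = b :=
  tendsto_nhds_unique ha hb

theorem HasGeneratorValue.add {P : ℝ≥0 → H →L[ℝ] H} {f g a b : H}
    (ha : HasGeneratorValue P f a) (hb : HasGeneratorValue P g b) :
    HasGeneratorValue P (f + g) (a + b) := by
  refine (Tendsto.add ha hb).congr fun t => ?_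
  rw [← smul_add, map_add]
  congr 1
  abel

theorem HasGeneratorValue.smul {P : ℝ≥0 → H →L[ℝ] H} {f a : H} (c : ℝ)
    (ha : HasGeneratorValue P f a) : HasGeneratorValue P (c • f) (c • a) := by
  refine (Tendsto.const_smul ha c).congr fun t => ?_
  rw [map_smul, ← smul_sub, smul_comm]

theorem HasGeneratorValue.zero (P : ℝ≥0 → H →L[ℝ] H) :
    HasGeneratorValue P 0 0 := by
  simp [HasGeneratorValue]

/-- The infinitesimal generator `A f = lim_{t ↓ 0} (P t f - f) / t`, an unbounded operator whose
domain is the set of all `f` for which this limit exists. -/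
noncomputable def generator (P : ℝ≥0 → H →L[ℝ] H) : H →ₗ.[ℝ] H where
  domain :=
    { carrier := {f | ∃ a, HasGeneratorValue P f a}
      add_mem' := fun ⟨_, ha⟩ ⟨_, hb⟩ => ⟨_, ha.add hb⟩
      zero_mem' := ⟨0, HasGeneratorValue.zero P⟩
      smul_mem' := fun c _ ⟨_, ha⟩ => ⟨_, ha.smul c⟩ }
  toFun :=
    { toFun := fun f => Classical.choose f.2
      map_add' := fun f g => (Classical.choose_spec (f + g).2).unique
        ((Classical.choose_spec f.2).add (Classical.choose_spec g.2))
      map_smul' := fun c f => (Classical.choose_spec (c • f).2).unique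
        ((Classical.choose_spec f.2).smul c) }

/-- The inverse of `P t`, an unbounded operator whose domain is the range of `P t`. (Mathlib's
`LinearPMap.inverse` is meaningful only when `P t` is injective.) -/
noncomputable def inverseOp (P : ℝ≥0 → H →L[ℝ] H) (t : ℝ≥0) : H →ₗ.[ℝ] H :=
  ((P t : H →ₗ[ℝ] H).toPMap ⊤).inverse

/-- `u`, restricted to `[0, T]`, solves `u_t + A u = 0`, `u(0) = g`, where `A` is the generator
of `P`: it is norm continuous on `[0, T]`, equals `g` at time zero, and for `0 < t < T` the value
`u t` lies in the domain of `A` and `u` has the norm derivative `u_t` at `t` with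
`u_t + A (u t) = 0`. Values of `u` outside `[0, T]` play no role. -/
structure IsSolution (P : ℝ≥0 → H →L[ℝ] H) (T : ℝ≥0) (g : H) (u : ℝ → H) : Prop where
  continuousOn : ContinuousOn u (Icc 0 (T : ℝ))
  initial : u 0 = g
  equation : ∀ t ∈ Ioo 0 (T : ℝ), ∃ (v : H) (ht : u t ∈ (generator P).domain),
    HasDerivAt u v t ∧ v + generator P ⟨u t, ht⟩ = 0

end Operators

end BackwardCauchy

/-! If `u` solves the backward equation, then `P s (u s)` has derivative `P s (u_t + A u) = 0`, so
`P t (u t) = g` on all of `[0, T]`. Taking `t = T` puts `g` in the range of `P T`, and injectivity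
of each `P t` determines `u t`. Injectivity uses symmetry: `P (2 * s) f = 0` forces `‖P s f‖² = 0`,
and repeated halving with strong continuity gives `f = 0`. Conversely, if `g = P T f`, the candidate
is `u t = P (T - t) f`. It solves the equation because a symmetric semigroup is smoothing: `P s f`
lies in the domain for every `s > 0`. In place of the spectral theorem,
`norm_pow_sub_pow_add_two_le` gives a discrete decay estimate, which bounds the difference quotients
of `P` at `P s f` by `‖f‖ / s`; density of the domain turns the bound into convergence. -/

namespace BackwardCauchy

/-! ### Contraction semigroups: continuity, orbits, density of the domain. -/

section ContractionSemigroup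

variable {H : Type*} [NormedAddCommGroup H] [NormedSpace ℝ H] {P : ℝ≥0 → H →L[ℝ] H}

namespace IsContractionSemigroup

theorem add_apply (hP : IsContractionSemigroup P) (s t : ℝ≥0) (f : H) :
    P (s + t) f = P s (P t f) := by
  rw [hP.add]; rfl

theorem norm_apply_le (hP : IsContractionSemigroup P) (t : ℝ≥0) (f : H) : ‖P t f‖ ≤ ‖f‖ := by
  simpa using (P t).le_of_opNorm_le (hP.norm_le_one t) f

theorem pow_eq (hP : IsContractionSemigroup P) (t : ℝ≥0) (n : ℕ) : (P t) ^ n = P (n * t) := by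
  induction n with
  | zero => simp [hP.zero]; rfl
  | succ n ih =>
    rw [pow_succ', ih, Nat.cast_succ, add_mul, one_mul, add_comm, hP.add]; rfl

theorem tendsto_zero (hP : IsContractionSemigroup P) (f : H) :
    Tendsto (fun t : ℝ≥0 => P t f) (𝓝 0) (𝓝 f) := by
  have h0 : (𝓝 (0 : ℝ≥0)) = 𝓝[>] 0 ⊔ pure 0 := by
    have hset : Ioi (0 : ℝ≥0) = {0}ᶜ := by ext x; simp [pos_iff_ne_zero]
    rw [hset, nhdsNE_sup_pure]
  rw [h0]
  refine (hP.strongly_continuous f).sup ?_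
  have : P 0 f = f := by rw [hP.zero]; rfl
  rw [tendsto_pure_left]
  intro s hs
  rw [this]; exact mem_of_mem_nhds hs

theorem norm_sub_le (hP : IsContractionSemigroup P) (s t : ℝ≥0) (f : H) :
    ‖P t f - P s f‖ ≤ ‖P (nndist t s) f - f‖ := by
  wlog hst : s ≤ t generalizing s t
  · rw [norm_sub_rev, nndist_comm]; exact this t s (le_of_not_ge hst)
  have h1 : t = s + nndist t s := by
    apply NNReal.coe_injective
    rw [NNReal.coe_add, coe_nndist, NNReal.dist_eq,
      abs_of_nonneg (sub_nonneg.2 (NNReal.coe_le_coe.2 hst))]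
    ring
  calc ‖P t f - P s f‖ = ‖P s (P (nndist t s) f - f)‖ := by
        rw [map_sub, ← hP.add_apply, ← h1]
    _ ≤ _ := hP.norm_apply_le _ _

theorem continuous_apply (hP : IsContractionSemigroup P) (f : H) :
    Continuous fun t : ℝ≥0 => P t f := by
  rw [continuous_iff_continuousAt]
  intro s
  rw [ContinuousAt, tendsto_iff_norm_sub_tendsto_zero]
  refine squeeze_zero (fun _ => norm_nonneg _) (fun t => hP.norm_sub_le s t f) ?_
  rw [← tendsto_iff_norm_sub_tendsto_zero]
  refine (hP.tendsto_zero f).comp ?_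
  have : Tendsto (fun t : ℝ≥0 => nndist t s) (𝓝 s) (𝓝 (nndist s s)) :=
    (continuous_id.nndist continuous_const).tendsto s
  simpa using this

/-- Contractivity upgrades strong continuity to joint continuity in time and vector. -/
theorem tendsto_apply (hP : IsContractionSemigroup P) {α : Type*} {l : Filter α} {τ : α → ℝ≥0}
    {x : α → H} {s : ℝ≥0} {y : H} (hτ : Tendsto τ l (𝓝 s)) (hx : Tendsto x l (𝓝 y)) :
    Tendsto (fun a => P (τ a) (x a)) l (𝓝 (P s y)) := by
  have h1 : Tendsto (fun a => P (τ a) y) l (𝓝 (P s y)) :=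
    ((hP.continuous_apply y).tendsto s).comp hτ
  have h2 : Tendsto (fun a => P (τ a) (x a - y)) l (𝓝 0) := by
    refine squeeze_zero_norm (fun a => hP.norm_apply_le _ _) ?_
    exact tendsto_iff_norm_sub_tendsto_zero.1 hx
  simpa using h2.add h1

theorem hasGeneratorValue_iff_real {f a : H} :
    HasGeneratorValue P f a ↔
      Tendsto (fun h : ℝ => h⁻¹ • (P h.toNNReal f - f)) (𝓝[>] 0) (𝓝 a) := by
  have hto : Tendsto Real.toNNReal (𝓝[>] (0 : ℝ)) (𝓝[>] (0 : ℝ≥0)) := by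
    refine tendsto_nhdsWithin_iff.2 ⟨?_, ?_⟩
    · have := (continuous_real_toNNReal.tendsto 0).mono_left (nhdsWithin_le_nhds (s := Ioi 0))
      simpa using this
    · filter_upwards [self_mem_nhdsWithin] with x hx
      simpa using hx
  have hcoe : Tendsto ((↑) : ℝ≥0 → ℝ) (𝓝[>] (0 : ℝ≥0)) (𝓝[>] (0 : ℝ)) := by
    refine tendsto_nhdsWithin_iff.2 ⟨?_, ?_⟩
    · have := (NNReal.continuous_coe.tendsto 0).mono_left (nhdsWithin_le_nhds (s := Ioi 0))
      simpa using this
    · filter_upwards [self_mem_nhdsWithin] with x hx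
      simpa using hx
  constructor
  · intro h
    refine (h.comp hto).congr' ?_
    filter_upwards [self_mem_nhdsWithin] with x hx
    simp [Real.coe_toNNReal x (le_of_lt hx)]
  · intro h
    refine (h.comp hcoe).congr fun x => ?_
    simp

theorem hasGeneratorValue_generator (f : (generator P).domain) :
    HasGeneratorValue P f (generator P f) :=
  Classical.choose_spec f.2

theorem exists_generator_eq {f a : H} (h : HasGeneratorValue P f a) :
    ∃ hf : f ∈ (generator P).domain, generator P ⟨f, hf⟩ = a :=
  ⟨⟨a, h⟩, (hasGeneratorValue_generator ⟨f, ⟨a, h⟩⟩).unique h⟩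

theorem hasGeneratorValue_apply (hP : IsContractionSemigroup P) {f a : H}
    (h : HasGeneratorValue P f a) (s : ℝ≥0) : HasGeneratorValue P (P s f) (P s a) := by
  refine (((P s).continuous.tendsto a).comp h).congr fun t => ?_
  simp only [Function.comp_apply, map_smul, map_sub]
  rw [← hP.add_apply, ← hP.add_apply, add_comm]

/-- Orbits starting in the domain of the generator are differentiable. -/
theorem hasDerivAt_apply (hP : IsContractionSemigroup P) {f a : H}
    (h : HasGeneratorValue P f a) {s : ℝ} (hs : 0 < s) :
    HasDerivAt (fun t : ℝ => P t.toNNReal f) (P s.toNNReal a) s := by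
  rw [hasDerivAt_iff_tendsto_slope]
  rw [hasGeneratorValue_iff_real] at h
  have h1 : Tendsto (fun t : ℝ => |t - s|) (𝓝[≠] s) (𝓝[>] 0) := by
    refine tendsto_nhdsWithin_iff.2 ⟨?_, ?_⟩
    · have : Continuous fun t : ℝ => |t - s| := by fun_prop
      simpa using (this.tendsto s).mono_left (nhdsWithin_le_nhds (s := {s}ᶜ))
    · filter_upwards [self_mem_nhdsWithin] with t ht
      exact abs_pos.2 (sub_ne_zero.2 ht)
  have h2 : Tendsto (fun t : ℝ => (min t s).toNNReal) (𝓝[≠] s) (𝓝 s.toNNReal) := by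
    have : Continuous fun t : ℝ => (min t s).toNNReal :=
      continuous_real_toNNReal.comp (continuous_id.min continuous_const)
    simpa using (this.tendsto s).mono_left (nhdsWithin_le_nhds (s := {s}ᶜ))
  -- Both one-sided slopes at once: `P (min t s)` factors out, leaving the generator quotient with
  -- increment `|t - s|`.
  refine (hP.tendsto_apply h2 (h.comp h1)).congr' ?_
  have h3 : ∀ᶠ t in 𝓝[≠] s, 0 < t := nhdsWithin_le_nhds (lt_mem_nhds hs)
  filter_upwards [h3] with t ht
  simp only [Function.comp_apply, map_smul, map_sub, slope_def_module, ← hP.add_apply]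
  rcases le_total t s with hts | hts
  · rw [min_eq_left hts, abs_of_nonpos (sub_nonpos.2 hts), neg_sub,
      ← Real.toNNReal_add ht.le (sub_nonneg.2 hts), add_sub_cancel, ← neg_sub s t, inv_neg,
      neg_smul, ← smul_neg, neg_sub]
  · rw [min_eq_right hts, abs_of_nonneg (sub_nonneg.2 hts),
      ← Real.toNNReal_add hs.le (sub_nonneg.2 hts), add_sub_cancel]

/-- The means `h⁻¹ • ∫₀ʰ P t f` lie in the domain, since applying `P` shifts the interval of
integration, and they tend to `f`. -/
theorem dense_domain_generator [CompleteSpace H] (hP : IsContractionSemigroup P) :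
    Dense ((generator P).domain : Set H) := by
  intro f
  have hc : Continuous fun t : ℝ => P t.toNNReal f :=
    (hP.continuous_apply f).comp continuous_real_toNNReal
  have hint : ∀ a b : ℝ, IntervalIntegrable (fun t : ℝ => P t.toNNReal f) volume a b :=
    fun a b => hc.intervalIntegrable a b
  have hder : ∀ b : ℝ, HasDerivAt (fun x => ∫ t in (0 : ℝ)..x, P t.toNNReal f)
      (P b.toNNReal f) b := fun b => hc.integral_hasStrictDerivAt 0 b |>.hasDerivAt
  have hslope : ∀ b : ℝ, Tendsto (fun h : ℝ => h⁻¹ • ((∫ t in (0 : ℝ)..(b + h), P t.toNNReal f) -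
      ∫ t in (0 : ℝ)..b, P t.toNNReal f)) (𝓝[>] 0) (𝓝 (P b.toNNReal f)) := fun b =>
    (hasDerivAt_iff_tendsto_slope_zero.1 (hder b)).mono_left
      (nhdsWithin_mono _ fun x hx => ne_of_gt hx)
  have hmem : ∀ ε : ℝ, 0 < ε → (∫ t in (0 : ℝ)..ε, P t.toNNReal f) ∈ (generator P).domain := by
    intro ε hε
    refine ⟨P ε.toNNReal f - P (0 : ℝ).toNNReal f, hasGeneratorValue_iff_real.2 ?_⟩
    refine ((hslope ε).sub (hslope 0)).congr' ?_
    filter_upwards [self_mem_nhdsWithin] with h hh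
    have hh : 0 < h := hh
    have hshift : P h.toNNReal (∫ t in (0 : ℝ)..ε, P t.toNNReal f) =
        ∫ t in h..(ε + h), P t.toNNReal f := by
      rw [← ContinuousLinearMap.intervalIntegral_comp_comm _ (hint 0 ε)]
      have : ∫ t in (0 : ℝ)..ε, P h.toNNReal (P t.toNNReal f) =
          ∫ t in (0 : ℝ)..ε, P (t + h).toNNReal f := by
        refine intervalIntegral.integral_congr fun t ht => ?_
        rw [uIcc_of_le hε.le] at ht
        rw [← hP.add_apply, add_comm t h, Real.toNNReal_add hh.le ht.1]
      rw [this, intervalIntegral.integral_comp_add_right (fun t : ℝ => P t.toNNReal f), zero_add]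
    rw [hshift, ← smul_sub, ← intervalIntegral.integral_add_adjacent_intervals (hint 0 h)
      (hint h (ε + h))]
    simp only [intervalIntegral.integral_same, zero_add, sub_zero]
    congr 1
    abel
  have hlim : Tendsto (fun h : ℝ => h⁻¹ • ∫ t in (0 : ℝ)..h, P t.toNNReal f) (𝓝[>] 0) (𝓝 f) := by
    have h0 : P 0 f = f := by rw [hP.zero]; rfl
    simpa [h0] using hslope 0
  refine mem_closure_of_tendsto hlim ?_
  filter_upwards [self_mem_nhdsWithin] with h hh
  exact (generator P).domain.smul_mem _ (hmem h hh)

end IsContractionSemigroup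

end ContractionSemigroup

/-! ### Smoothing and injectivity from symmetry. -/

section Symmetric

variable {H : Type*} [NormedAddCommGroup H] [InnerProductSpace ℝ H]

/-- Powers of a symmetric contraction: the increment over two steps decays like the inverse of the
number of steps. -/
theorem norm_pow_sub_pow_add_two_le {B : H →L[ℝ] H} (hB : ‖B‖ ≤ 1)
    (hsymm : ∀ f g : H, inner ℝ (B f) g = inner ℝ f (B g)) (f : H) (n : ℕ) :
    (n + 1 : ℝ) * ‖(B ^ (n + 2)) f - (B ^ n) f‖ ≤ 2 * ‖f‖ := by
  have hle : ∀ x : H, ‖B x‖ ≤ ‖x‖ := fun x => by simpa using B.le_of_opNorm_le hB x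
  have hsucc : ∀ k, (B ^ (k + 1)) f = B ((B ^ k) f) := fun k => by rw [pow_succ']; rfl
  set y : ℕ → H := fun k => (B ^ k) f with hy
  have hys : ∀ k, y (k + 1) = B (y k) := hsucc
  have hφ : ∀ k, ‖y (k + 1)‖ ^ 2 ≤ ‖y k‖ ^ 2 := fun k => by
    rw [hys]; exact pow_le_pow_left₀ (norm_nonneg _) (hle _) 2
  -- Two-step increments make the cross term a square by symmetry, so no positivity of `B` is
  -- needed.
  have hψ : ∀ k, ‖y (k + 2) - y k‖ ^ 2 =
      ‖y k‖ ^ 2 - 2 * ‖y (k + 1)‖ ^ 2 + ‖y (k + 2)‖ ^ 2 := fun k => by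
    have : inner ℝ (y (k + 2)) (y k) = ‖y (k + 1)‖ ^ 2 := by
      rw [hys (k + 1), hsymm, ← hys k, real_inner_self_eq_norm_sq]
    rw [norm_sub_sq_real, this]; ring
  have hψa : ∀ k, ‖y (k + 1 + 2) - y (k + 1)‖ ^ 2 ≤ ‖y (k + 2) - y k‖ ^ 2 := fun k => by
    have : y (k + 1 + 2) - y (k + 1) = B (y (k + 2) - y k) := by
      rw [map_sub, ← hys, ← hys]
    rw [this]; exact pow_le_pow_left₀ (norm_nonneg _) (hle _) 2
  -- Summation by parts of `∑ (j + 1) ψ j`, where `ψ j = ‖y (j + 2) - y j‖²` is the second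
  -- difference of `‖y j‖²`; as `ψ` decreases, the sum is at least `(k + 1) (k + 2) / 2 * ψ k`.
  have key : ∀ k : ℕ, (k + 1 : ℝ) * (k + 2) / 2 * ‖y (k + 2) - y k‖ ^ 2 +
      (k + 1) * (‖y (k + 1)‖ ^ 2 - ‖y (k + 2)‖ ^ 2) ≤ ‖y 0‖ ^ 2 - ‖y (k + 1)‖ ^ 2 := by
    intro k
    induction k with
    | zero => have := hψ 0; norm_num at this ⊢; linarith
    | succ k ih =>
      have h1 := hψa k
      have h2 := hψ (k + 1)
      have h3 := mul_le_mul_of_nonneg_left h1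
        (by positivity : (0 : ℝ) ≤ (k + 1 : ℝ) * (k + 2) / 2)
      have h4 : (k + 2 : ℝ) * ‖y (k + 1 + 2) - y (k + 1)‖ ^ 2 =
          (k + 2) * (‖y (k + 1)‖ ^ 2 - 2 * ‖y (k + 1 + 1)‖ ^ 2 + ‖y (k + 1 + 2)‖ ^ 2) := by
        rw [h2]
      push_cast
      simp only [add_assoc, Nat.reduceAdd] at *
      linarith
  have hk := key n
  have h1 := mul_nonneg (by positivity : (0 : ℝ) ≤ n + 1) (sub_nonneg.2 (hφ (n + 1)))
  have h2 : (0 : ℝ) ≤ ‖y (n + 1)‖ ^ 2 := by positivity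
  have h3 : y 0 = f := by simp [hy]
  rw [h3] at hk
  refine le_of_sq_le_sq ?_ (by positivity)
  have h4 : (0 : ℝ) ≤ (n + 1 : ℝ) * ‖y (n + 2) - y n‖ ^ 2 := by positivity
  have h5 : (0 : ℝ) ≤ ‖f‖ ^ 2 := by positivity
  change ((n + 1 : ℝ) * ‖y (n + 2) - y n‖) ^ 2 ≤ _
  linarith

variable {P : ℝ≥0 → H →L[ℝ] H}

namespace IsContractionSemigroup

theorem norm_apply_add_sub_le (hP : IsContractionSemigroup P)
    (hsymm : ∀ (t : ℝ≥0) (f g : H), inner ℝ (P t f) g = inner ℝ f (P t g))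
    (s h : ℝ≥0) (hh : 0 < h) (f : H) :
    (s : ℝ) * ‖P h (P s f) - P s f‖ ≤ h * ‖f‖ := by
  -- Half of `h` is the unit step, so that `P h` is two steps of `P d`; the remainder of `s` modulo
  -- `d` costs nothing by contractivity.
  obtain ⟨d, rfl⟩ : ∃ d, h = 2 * d := ⟨h / 2, by rw [mul_div_cancel₀ _ two_ne_zero]⟩
  have hd : 0 < d := by simpa using hh
  set n := ⌊s / d⌋₊ with hn
  have hn1 : (n : ℝ≥0) * d ≤ s := (le_div_iff₀ hd).1 (Nat.floor_le (by positivity))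
  have hn2 : s ≤ ((n : ℝ≥0) + 1) * d := ((div_lt_iff₀ hd).1 (Nat.lt_floor_add_one _)).le
  obtain ⟨r, hr⟩ := exists_add_of_le hn1
  have h1 := norm_pow_sub_pow_add_two_le (hP.norm_le_one d) (hsymm d) f n
  have h2 : ‖P (2 * d) (P s f) - P s f‖ ≤ ‖(P d ^ (n + 2)) f - (P d ^ n) f‖ := by
    have e1 : P (2 * d) (P s f) = P r ((P d ^ (n + 2)) f) := by
      rw [hP.pow_eq, ← hP.add_apply, ← hP.add_apply, hr]
      congr 2; push_cast; ring
    have e2 : P s f = P r ((P d ^ n) f) := by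
      rw [hP.pow_eq, ← hP.add_apply, hr, add_comm]
    rw [e1, e2, ← map_sub]
    exact hP.norm_apply_le _ _
  have h3 : (s : ℝ) ≤ (n + 1) * d := by exact_mod_cast hn2
  calc (s : ℝ) * ‖P (2 * d) (P s f) - P s f‖
      ≤ ((n + 1) * d) * ‖(P d ^ (n + 2)) f - (P d ^ n) f‖ := by gcongr
    _ = d * ((n + 1) * ‖(P d ^ (n + 2)) f - (P d ^ n) f‖) := by ring
    _ ≤ d * (2 * ‖f‖) := by gcongr
    _ = _ := by push_cast; ring

/-- A symmetric contraction semigroup maps into the domain of its generator at positive times. -/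
theorem exists_hasGeneratorValue_apply [CompleteSpace H] (hP : IsContractionSemigroup P)
    (hsymm : ∀ (t : ℝ≥0) (f g : H), inner ℝ (P t f) g = inner ℝ f (P t g))
    {s : ℝ≥0} (hs : 0 < s) (f : H) : ∃ a, HasGeneratorValue P (P s f) a := by
  have hs' : (0 : ℝ) < s := hs
  have hbound : ∀ h : ℝ≥0, 0 < h → ∀ x : H,
      ‖(h : ℝ)⁻¹ • (P h (P s x) - P s x)‖ ≤ ‖x‖ / s := by
    intro h hh x
    have hh' : (0 : ℝ) < h := hh
    rw [norm_smul, norm_inv, Real.norm_of_nonneg hh'.le, le_div_iff₀ hs', inv_mul_eq_div,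
      div_mul_eq_mul_div, div_le_iff₀ hh']
    have := hP.norm_apply_add_sub_le hsymm s h hh x
    linarith
  refine cauchy_map_iff_exists_tendsto.1 (Metric.cauchy_iff.2 ⟨inferInstance, fun ε hε => ?_⟩)
  -- Replacing `f` by `k` changes every quotient by at most `‖f - k‖ / s < ε / 4`, uniformly in `h`.
  obtain ⟨k, hk, hfk⟩ := Metric.dense_iff.1 hP.dense_domain_generator f (ε * s / 4) (by positivity)
  obtain ⟨a, ha⟩ := hfk
  have ha := hP.hasGeneratorValue_apply ha s
  have hev := ha.eventually (Metric.ball_mem_nhds (P s a) (show 0 < ε / 4 by positivity))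
  refine ⟨Metric.ball (P s a) (ε / 2), ?_, fun x hx y hy => ?_⟩
  · rw [mem_map]
    filter_upwards [hev, self_mem_nhdsWithin] with h h1 h2
    have h3 := hbound h h2 (f - k)
    have h4 : ‖f - k‖ / s < ε / 4 := by
      rw [div_lt_iff₀ hs']
      rw [Metric.mem_ball, dist_comm, dist_eq_norm] at hk
      linarith
    rw [mem_preimage, Metric.mem_ball]
    refine (dist_triangle _ ((h : ℝ)⁻¹ • (P h (P s k) - P s k)) _).trans_lt ?_
    have h5 : dist ((h : ℝ)⁻¹ • (P h (P s f) - P s f)) ((h : ℝ)⁻¹ • (P h (P s k) - P s k)) =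
        ‖(h : ℝ)⁻¹ • (P h (P s (f - k)) - P s (f - k))‖ := by
      rw [dist_eq_norm, ← smul_sub]
      simp only [map_sub]
      congr 2; abel
    have h1 : dist ((h : ℝ)⁻¹ • (P h (P s k) - P s k)) (P s a) < ε / 4 := h1
    linarith
  · have := dist_triangle_right x y (P s a)
    rw [Metric.mem_ball] at hx hy
    linarith

theorem injective_of_symmetric (hP : IsContractionSemigroup P)
    (hsymm : ∀ (t : ℝ≥0) (f g : H), inner ℝ (P t f) g = inner ℝ f (P t g)) (T : ℝ≥0) :
    Function.Injective (P T) := by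
  rw [injective_iff_map_eq_zero]
  intro f hf
  have h1 : ∀ n : ℕ, P (T * (1 / 2) ^ n) f = 0 := by
    intro n
    induction n with
    | zero => simpa using hf
    | succ n ih =>
      have h2 : T * (1 / 2) ^ n = T * (1 / 2) ^ (n + 1) + T * (1 / 2) ^ (n + 1) := by
        rw [pow_succ, ← mul_add, ← mul_add, add_halves, mul_one]
      -- `‖P s f‖² = ⟪f, P (2 * s) f⟫`.
      rw [← inner_self_eq_zero (𝕜 := ℝ), hsymm, ← hP.add_apply, ← h2, ih, inner_zero_right]
  have h2 : Tendsto (fun n : ℕ => T * (1 / 2 : ℝ≥0) ^ n) atTop (𝓝 0) := by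
    have h := (NNReal.tendsto_pow_atTop_nhds_zero_of_lt_one (r := (1 / 2 : ℝ≥0)) (by
      rw [← NNReal.coe_lt_coe]; norm_num)).const_mul T
    simpa using h
  have h3 := (hP.tendsto_zero f).comp h2
  refine tendsto_nhds_unique h3 ?_
  simp only [Function.comp_def, h1]
  exact tendsto_const_nhds

end IsContractionSemigroup

/-! ### The backward Cauchy problem and the inverse operator. -/

/-- A solution of the backward Cauchy problem is carried back to its initial value. -/
theorem IsSolution.apply_eq (hP : IsContractionSemigroup P) {T : ℝ≥0} {g : H} {u : ℝ → H}
    (hu : IsSolution P T g u) {t : ℝ} (ht : t ∈ Icc 0 (T : ℝ)) : P t.toNNReal (u t) = g := by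
  have h0 : P 0 g = g := by rw [hP.zero]; rfl
  rcases ht.1.eq_or_lt with rfl | ht0
  · simpa [hu.initial] using h0
  set F : ℝ → H := fun s => P s.toNNReal (u s) with hF
  have hcont : ContinuousOn F (Icc 0 t) := by
    intro s hs
    exact hP.tendsto_apply ((continuous_real_toNNReal.tendsto s).mono_left nhdsWithin_le_nhds)
      ((hu.continuousOn.mono (Icc_subset_Icc_right ht.2)) s hs)
  have hder : ∀ s ∈ Ioo 0 t, HasDerivAt F 0 s := by
    intro s hs
    obtain ⟨v, hmem, hv, hve⟩ := hu.equation s ⟨hs.1, hs.2.trans_le ht.2⟩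
    have h1 := hP.hasDerivAt_apply
      (IsContractionSemigroup.hasGeneratorValue_generator ⟨u s, hmem⟩) hs.1
    rw [hasDerivAt_iff_tendsto_slope] at h1 hv ⊢
    -- Product rule: the slope of `F` is `P r` of the slope of `u` plus the slope of the orbit of
    -- the fixed vector `u s`.
    have h2 := (hP.tendsto_apply ((continuous_real_toNNReal.tendsto s).mono_left
      (nhdsWithin_le_nhds (s := {s}ᶜ))) hv).add h1
    rw [← map_add, hve, map_zero] at h2
    refine h2.congr fun r => ?_
    simp only [slope_def_module, hF, map_smul, map_sub, ← smul_add]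
    congr 1
    abel
  -- Testing against `w` reduces constancy to the scalar mean value theorem, which needs derivatives
  -- only in the interior.
  have hconst : ∀ w : H, inner ℝ w (F t) = inner ℝ w (F 0) := by
    intro w
    obtain ⟨c, hc, he⟩ := exists_hasDerivAt_eq_slope (fun s => inner ℝ w (F s)) (fun _ => 0) ht0
      (continuousOn_const.inner hcont) fun s hs => by
        simpa using (hasDerivAt_const s w).inner ℝ (hder s hs)
    rw [eq_comm, div_eq_zero_iff] at he
    rcases he with he | he
    · linarith
    · linarith
  have h1 : F t = F 0 := ext_inner_left ℝ hconst
  rw [show P t.toNNReal (u t) = F t from rfl, h1]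
  simpa [hF, hu.initial] using h0

theorem isSolution_apply_sub [CompleteSpace H] (hP : IsContractionSemigroup P)
    (hsymm : ∀ (t : ℝ≥0) (f g : H), inner ℝ (P t f) g = inner ℝ f (P t g)) (T : ℝ≥0) (f : H) :
    IsSolution P T (P T f) fun t => P ((T : ℝ) - t).toNNReal f where
  continuousOn := ((hP.continuous_apply f).comp
    (continuous_real_toNNReal.comp (continuous_const.sub continuous_id))).continuousOn
  initial := by simp
  equation := by
    intro t ht
    -- Half the remaining time moves `f` into the domain; the other half leaves a positive time at
    -- which the orbit of `P r f` is differentiable.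
    have hr : 0 < ((T : ℝ) - t) / 2 := by linarith [ht.2]
    set r : ℝ := ((T : ℝ) - t) / 2 with hrdef
    have hr2 : (T : ℝ) - t = r + r := by rw [hrdef]; ring
    obtain ⟨a, ha⟩ := hP.exists_hasGeneratorValue_apply hsymm (Real.toNNReal_pos.2 hr) f
    have hval : HasGeneratorValue P (P ((T : ℝ) - t).toNNReal f) (P r.toNNReal a) := by
      rw [hr2, Real.toNNReal_add hr.le hr.le, hP.add_apply]
      exact hP.hasGeneratorValue_apply ha _
    obtain ⟨hmem, hgen⟩ := IsContractionSemigroup.exists_generator_eq hval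
    refine ⟨-P r.toNNReal a, hmem, ?_, ?_⟩
    · have h1 := hP.hasDerivAt_apply ha hr
      have h2 : HasDerivAt (fun x : ℝ => (T : ℝ) - r - x) (-1) t := by
        simpa using (hasDerivAt_id t).const_sub ((T : ℝ) - r)
      have h3 : (T : ℝ) - r - t = r := by linarith
      rw [← h3] at h1
      have h4 := h1.scomp t h2
      rw [h3, neg_smul, one_smul] at h4
      refine h4.congr_of_eventuallyEq ?_
      have h5 : ∀ᶠ x in 𝓝 t, x < t + r := gt_mem_nhds (by linarith)
      filter_upwards [h5] with x hx
      have h6 : 0 ≤ (T : ℝ) - r - x := by linarith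
      rw [Function.comp_apply, ← hP.add_apply, ← Real.toNNReal_add h6 hr.le]
      congr 3; ring
    · rw [hgen, neg_add_cancel]

theorem mem_inverseOp_domain {T : ℝ≥0} {g : H} :
    g ∈ (inverseOp P T).domain ↔ ∃ f, P T f = g := by
  rw [inverseOp, LinearPMap.inverse_domain, LinearMap.mem_range]
  constructor
  · rintro ⟨f, hf⟩; exact ⟨f, hf⟩
  · rintro ⟨f, hf⟩; exact ⟨⟨f, trivial⟩, hf⟩

theorem inverseOp_apply_eq {T : ℝ≥0} (hinj : Function.Injective (P T)) {f g : H}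
    (hf : P T f = g) (hg : g ∈ (inverseOp P T).domain) : inverseOp P T ⟨g, hg⟩ = f := by
  have hker : LinearMap.ker ((P T : H →ₗ[ℝ] H).toPMap ⊤).toFun = ⊥ := by
    rw [LinearMap.ker_eq_bot]
    intro x y hxy
    exact Subtype.ext (hinj hxy)
  exact LinearPMap.inverse_apply_eq hker (x := ⟨f, trivial⟩) hf

end Symmetric

end BackwardCauchy

theorem corollary2p3 {E : Type*} [MetricSpace E] [LocallyCompactSpace E]
    [TopologicalSpace.SeparableSpace E] [MeasurableSpace E] [BorelSpace E]
    (m : Measure E) [SigmaFinite m] [m.IsOpenPosMeasure]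
    (p : ℝ≥0 → Kernel E E) (P : ℝ≥0 → Lp ℝ 2 m →L[ℝ] Lp ℝ 2 m)
    (hP : BackwardCauchy.IsSymmetricL2Semigroup m p P)
    (T : ℝ≥0) (hT : 0 < T) :
    Function.Injective (P T) ∧
    ∀ g : Lp ℝ 2 m,
      (g ∈ (BackwardCauchy.inverseOp P T).domain →
        ∃ u : ℝ → Lp ℝ 2 m, BackwardCauchy.IsSolution P T g u) ∧
      ((∃ u : ℝ → Lp ℝ 2 m, BackwardCauchy.IsSolution P T g u) →
        g ∈ (BackwardCauchy.inverseOp P T).domain) ∧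
      ((∃ u : ℝ → Lp ℝ 2 m, BackwardCauchy.IsSolution P T g u ∧
          ∀ v : ℝ → Lp ℝ 2 m, BackwardCauchy.IsSolution P T g v →
            EqOn v u (Icc 0 (T : ℝ))) ↔
        g ∈ (BackwardCauchy.inverseOp P T).domain) ∧
      (∀ u : ℝ → Lp ℝ 2 m, BackwardCauchy.IsSolution P T g u →
        ∃ hg : g ∈ (BackwardCauchy.inverseOp P T).domain,
          BackwardCauchy.inverseOp P T ⟨g, hg⟩ = u (T : ℝ)) := by
  have hS := hP.semigroup
  have hsymm := hP.symmetric
  have hinj := hS.injective_of_symmetric hsymm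
  have hback : ∀ (g : Lp ℝ 2 m) (u : ℝ → Lp ℝ 2 m), BackwardCauchy.IsSolution P T g u →
      P T (u T) = g := fun g u hu => by
    simpa using hu.apply_eq hS (right_mem_Icc.2 T.2)
  have hex : ∀ g : Lp ℝ 2 m, g ∈ (BackwardCauchy.inverseOp P T).domain →
      ∃ u : ℝ → Lp ℝ 2 m, BackwardCauchy.IsSolution P T g u := fun g hg => by
    obtain ⟨f, rfl⟩ := BackwardCauchy.mem_inverseOp_domain.1 hg
    exact ⟨_, BackwardCauchy.isSolution_apply_sub hS hsymm T f⟩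
  have hmem : ∀ (g : Lp ℝ 2 m) (u : ℝ → Lp ℝ 2 m), BackwardCauchy.IsSolution P T g u →
      g ∈ (BackwardCauchy.inverseOp P T).domain := fun g u hu =>
    BackwardCauchy.mem_inverseOp_domain.2 ⟨_, hback g u hu⟩
  refine ⟨hinj T, fun g => ⟨hex g, fun ⟨u, hu⟩ => hmem g u hu,
    ⟨fun ⟨u, hu, _⟩ => hmem g u hu, fun hg => ?_⟩, fun u hu => ⟨hmem g u hu, ?_⟩⟩⟩
  · obtain ⟨u, hu⟩ := hex g hg
    -- Injectivity is needed at every `t` in `[0, T]`, not only at `T`.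
    refine ⟨u, hu, fun v hv t ht => hinj t.toNNReal ?_⟩
    rw [hu.apply_eq hS ht, hv.apply_eq hS ht]
  · exact BackwardCauchy.inverseOp_apply_eq (hinj T) (hback g u hu) _
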